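/- Let $X$ be a metrizable space, $Y$ a regular space, and let $f\colon X\to Y$ be a $\mathbf{\Sigma}^0_2$-measurable map, that is, $f^{-1}(U)$ is a countable union of closed subsets of $X$ for every open $U\subset Y$. Suppose that $f$ is not piecewise continuous, that is, $X$ cannot be covered by a sequence $X_0,X_1,\ldots$ of closed sets such that each restriction $f\restriction X_n$ is continuous. Then there is a subset $Z\subset X$ such that: 1. $Z$ (with the subspace topology) is homeomorphic to the space $\mathbb Q$ of rational numbers; 2. the restriction $f\restriction Z$ is a bijection of $Z$ onto $f(Z)$; 3. $f(Z)$ is relatively discrete in $Y$, that is, for every $a\in f(Z)$ there is an open set $U\subset Y$ with $U\cap f(Z)=\{a\}$; 4. $\dim\overline Z=0$, where $\overline Z$ is the closure of $Z$ in $X$ and $\dim$ is the covering dimension. -/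

import Mathlib

/-- `s` belongs to the class `Σ⁰₂(X)`: it is the union of countably many closed sets. -/
def IsSigmaTwo {X : Type*} [TopologicalSpace X] (s : Set X) : Prop :=
  ∃ F : ℕ → Set X, (∀ n, IsClosed (F n)) ∧ s = ⋃ n, F n

/-- `f` is `Σ⁰₂`-measurable: the preimage of every open set is a `Σ⁰₂`-set. -/
def SigmaTwoMeasurable {X Y : Type*} [TopologicalSpace X] [TopologicalSpace Y]
    (f : X → Y) : Prop :=
  ∀ U : Set Y, IsOpen U → IsSigmaTwo (f ⁻¹' U)

/-- `f` is piecewise continuous: `X` is covered by a sequence of closed sets such that the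
restriction of `f` to each of them is continuous. -/
def PiecewiseContinuous {X Y : Type*} [TopologicalSpace X] [TopologicalSpace Y]
    (f : X → Y) : Prop :=
  ∃ F : ℕ → Set X, (∀ n, IsClosed (F n)) ∧ (⋃ n, F n) = Set.univ ∧
    ∀ n, ContinuousOn f (F n)

/-- `A` is relatively discrete: every point `a` of `A` has an open neighbourhood in the ambient
space that meets `A` in `a` only. -/
def RelativelyDiscrete {Y : Type*} [TopologicalSpace Y] (A : Set Y) : Prop :=
  ∀ a ∈ A, ∃ U : Set Y, IsOpen U ∧ U ∩ A = {a}

/-- `dim X ≤ n`: every finite open cover of `X` has a finite open refinement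
of order at most `n`, i.e. one in which every point lies in at most `n + 1` members. -/
def CoveringDimLE (X : Type*) [TopologicalSpace X] (n : ℕ) : Prop :=
  ∀ 𝒰 : Set (Set X), 𝒰.Finite → (∀ U ∈ 𝒰, IsOpen U) → ⋃₀ 𝒰 = Set.univ →
    ∃ 𝒱 : Set (Set X), 𝒱.Finite ∧ (∀ V ∈ 𝒱, IsOpen V) ∧ ⋃₀ 𝒱 = Set.univ ∧
      (∀ V ∈ 𝒱, ∃ U ∈ 𝒰, V ⊆ U) ∧ ∀ x : X, {V ∈ 𝒱 | x ∈ V}.ncard ≤ n + 1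

open Classical in
/-- The covering dimension `dim X` (of a normal space): the least `n` with `dim X ≤ n`, and `⊤` if
there is none. The dimension `-1` of the empty space is written `⊥`. -/
noncomputable def coveringDim (X : Type*) [TopologicalSpace X] : WithBot ℕ∞ :=
  if IsEmpty X then ⊥ else ((⨅ (n : ℕ) (_ : CoveringDimLE X n), (n : ℕ∞) : ℕ∞) : WithBot ℕ∞)

open Set Topology TopologicalSpace

/-! Call a set large at `x` if it meets no neighbourhood of `x` in a set covered by countably many
closed sets of continuity of `f`. If a Σ⁰₂ set `S` has no such cover, discarding its locally
coverable part leaves a set on which `f` is discontinuous. Comparing two separated values there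
yields a point `x` of `S` at which `S` stays large after removal of the preimage of the closure of a
neighbourhood of `f x` (`exists_germLarge`). That neighbourhood can be chosen to spare finitely many
large germs already in use (`exists_germLarge_preserving`).

A finite set can thus grow point by point. New values avoid fixed neighbourhoods of the old ones,
which gives injectivity and discreteness; large germs allow new points arbitrarily near every old
one. The union `Z` is countable without isolated points. Confining it to ever smaller separated
balls gives its closure arbitrarily fine clopen partitions, hence dimension zero, and Sierpiński's
theorem identifies `Z` with `ℚ`. -/

theorem IsClosed.isSigmaTwo {X : Type*} [TopologicalSpace X] {s : Set X} (hs : IsClosed s) :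
    IsSigmaTwo s :=
  ⟨fun _ => s, fun _ => hs, (iUnion_const s).symm⟩

theorem IsOpen.isSigmaTwo {X : Type*} [TopologicalSpace X] [PseudoMetrizableSpace X] {s : Set X}
    (hs : IsOpen s) : IsSigmaTwo s := by
  let := pseudoMetrizableSpacePseudoMetric X
  obtain ⟨F, hF, -, hU, -⟩ := hs.exists_iUnion_isClosed
  exact ⟨F, hF, hU.symm⟩

theorem IsSigmaTwo.inter {X : Type*} [TopologicalSpace X] {s t : Set X} (hs : IsSigmaTwo s)
    (ht : IsSigmaTwo t) : IsSigmaTwo (s ∩ t) := by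
  obtain ⟨F, hF, rfl⟩ := hs
  obtain ⟨G, hG, rfl⟩ := ht
  refine ⟨fun n => F n.unpair.1 ∩ G n.unpair.2, fun n => (hF _).inter (hG _), ?_⟩
  ext x
  simp only [mem_inter_iff, mem_iUnion]
  constructor
  · rintro ⟨⟨i, hi⟩, j, hj⟩
    exact ⟨Nat.pair i j, by simpa using ⟨hi, hj⟩⟩
  · rintro ⟨n, h1, h2⟩
    exact ⟨⟨_, h1⟩, _, h2⟩

/-! ### Countable closed covers by sets of continuity -/

/-- `A` is covered by countably many closed sets of the ambient space, on each of which `f` is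
continuous. -/
def ContinuouslyCovered {X Y : Type*} [TopologicalSpace X] [TopologicalSpace Y] (f : X → Y)
    (A : Set X) : Prop :=
  ∃ F : ℕ → Set X, (∀ n, IsClosed (F n)) ∧ A ⊆ ⋃ n, F n ∧ ∀ n, ContinuousOn f (F n)

section ContinuouslyCovered

variable {X Y : Type*} [TopologicalSpace X] [TopologicalSpace Y] {f : X → Y} {A B S : Set X}

theorem ContinuouslyCovered.mono (hB : ContinuouslyCovered f B) (h : A ⊆ B) :
    ContinuouslyCovered f A := by
  obtain ⟨F, hF, hc, hf⟩ := hB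
  exact ⟨F, hF, h.trans hc, hf⟩

theorem ContinuouslyCovered.piecewiseContinuous (h : ContinuouslyCovered f univ) :
    PiecewiseContinuous f := by
  obtain ⟨F, hF, hc, hf⟩ := h
  exact ⟨F, hF, univ_subset_iff.1 hc, hf⟩

theorem ContinuouslyCovered.iUnion {s : ℕ → Set X} (h : ∀ n, ContinuouslyCovered f (s n)) :
    ContinuouslyCovered f (⋃ n, s n) := by
  choose F hF hc hf using h
  refine ⟨fun n => F n.unpair.1 n.unpair.2, fun n => hF _ _, ?_, fun n => hf _ _⟩
  refine iUnion_subset fun i x hx => ?_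
  obtain ⟨j, hj⟩ := mem_iUnion.1 (hc i hx)
  exact mem_iUnion.2 ⟨Nat.pair i j, by simpa using hj⟩

theorem ContinuouslyCovered.union (hA : ContinuouslyCovered f A) (hB : ContinuouslyCovered f B) :
    ContinuouslyCovered f (A ∪ B) := by
  refine (ContinuouslyCovered.iUnion (s := fun n : ℕ => if n = 0 then A else B) fun n => ?_).mono ?_
  · split_ifs <;> assumption
  · rintro x (hx | hx)
    · exact mem_iUnion.2 ⟨0, by simpa using hx⟩
    · exact mem_iUnion.2 ⟨1, by simpa using hx⟩

theorem ContinuousOn.continuouslyCovered (hS : IsSigmaTwo S) (h : ContinuousOn f S) :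
    ContinuouslyCovered f S := by
  obtain ⟨F, hF, rfl⟩ := hS
  exact ⟨F, hF, subset_rfl, fun n => h.mono (subset_iUnion F n)⟩

/-- In a metrizable space, a set which is locally continuously covered is continuously covered. -/
theorem ContinuouslyCovered.of_locally [PseudoMetrizableSpace X] {ι : Type*} {W : ι → Set X}
    (hW : ∀ i, IsOpen (W i)) (h : ∀ i, ContinuouslyCovered f (W i ∩ S)) :
    ContinuouslyCovered f ((⋃ i, W i) ∩ S) := by
  let := pseudoMetrizableSpacePseudoMetric X
  obtain ⟨K, hK, hKe⟩ := (isOpen_iUnion hW).isSigmaTwo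
  rw [hKe, iUnion_inter]
  refine ContinuouslyCovered.iUnion fun m => ?_
  obtain ⟨v, -, hsv, hvf, hvW⟩ := precise_refinement_set (hK m) W hW
    (hKe ▸ subset_iUnion K m)
  choose C hC hcov hf using h
  -- For fixed `n` the family over `i` is locally finite, so its union is closed and `f` is
  -- continuous on it, however large `ι` is.
  refine ⟨fun n => ⋃ i, closure (v i) ∩ C i n, fun n => ?_, ?_, fun n => ?_⟩
  · exact (hvf.closure.subset fun i => inter_subset_left).isClosed_iUnion
      fun i => isClosed_closure.inter (hC i n)
  · rintro x ⟨hxK, hxS⟩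
    obtain ⟨i, hi⟩ := mem_iUnion.1 (hsv hxK)
    obtain ⟨n, hn⟩ := mem_iUnion.1 (hcov i ⟨hvW i hi, hxS⟩)
    exact mem_iUnion.2 ⟨n, mem_iUnion.2 ⟨i, subset_closure hi, hn⟩⟩
  · exact (hvf.closure.subset fun i => inter_subset_left).continuousOn_iUnion
      (fun i => isClosed_closure.inter (hC i n)) fun i => (hf i n).mono inter_subset_right

/-! ### Large germs -/

/-- No neighbourhood of `x` meets `S` in a continuously covered set. -/
def GermLarge (f : X → Y) (S : Set X) (x : X) : Prop :=
  ∀ W : Set X, IsOpen W → x ∈ W → ¬ ContinuouslyCovered f (W ∩ S)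

theorem GermLarge.mono {x : X} (h : GermLarge f A x) (hAB : A ⊆ B) : GermLarge f B x :=
  fun W hW hx hc => h W hW hx (hc.mono (inter_subset_inter_right W hAB))

theorem GermLarge.not_continuouslyCovered {x : X} (h : GermLarge f A x) :
    ¬ ContinuouslyCovered f A :=
  fun hc => h univ isOpen_univ trivial (hc.mono inter_subset_right)

theorem exists_open_disjoint_closure [RegularSpace Y] {C : Set Y} (hC : IsClosed C) {y : Y}
    (hy : y ∉ C) : ∃ V, IsOpen V ∧ y ∈ V ∧ Disjoint (closure V) C := by
  obtain ⟨V, hyV, hVc, hV⟩ := exists_mem_nhds_isClosed_subset (hC.isOpen_compl.mem_nhds hy)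
  refine ⟨interior V, isOpen_interior, mem_interior_iff_mem_nhds.2 hyV, ?_⟩
  exact disjoint_left.2 fun z hz => hV (closure_minimal interior_subset hVc hz)

/-- A set on which `f` is not piecewise continuous contains a point `x` such that arbitrarily near
`x`, the values of `f` far from `f x` form a complicated part of the set. -/
theorem exists_germLarge [PseudoMetrizableSpace X] [RegularSpace Y] (hS : IsSigmaTwo S)
    (hnc : ¬ ContinuouslyCovered f S) :
    ∃ x ∈ S, ∃ V, IsOpen V ∧ f x ∈ V ∧ GermLarge f (S ∩ f ⁻¹' (closure V)ᶜ) x := by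
  -- `G` is the largest open set whose trace on `S` is covered, so `S` is large at every point of `S
  -- \ G`.
  set G : Set X := ⋃ W : {W : Set X // IsOpen W ∧ ContinuouslyCovered f (W ∩ S)}, W.1 with hG
  have hGo : IsOpen G := isOpen_iUnion fun W => W.2.1
  have hGc : ContinuouslyCovered f (G ∩ S) :=
    ContinuouslyCovered.of_locally (fun W => W.2.1) fun W => W.2.2
  have hker : ∀ x ∈ S \ G, GermLarge f S x := fun x hx W hW hxW hc =>
    hx.2 (mem_iUnion.2 ⟨⟨W, hW, hc⟩, hxW⟩)
  have hncont : ¬ ContinuousOn f (S \ G) := fun hc => by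
    refine hnc ((hGc.union (hc.continuouslyCovered
      (hS.inter hGo.isClosed_compl.isSigmaTwo))).mono fun x hx => ?_)
    by_cases hxG : x ∈ G
    · exact Or.inl ⟨hxG, hx⟩
    · exact Or.inr ⟨hx, hxG⟩
  by_contra! hcon
  refine hncont fun x hx => ?_
  by_contra hcx
  obtain ⟨V', hV', hVx⟩ : ∃ V' ∈ 𝓝 (f x), f ⁻¹' V' ∉ 𝓝[S \ G] x := by
    simpa [ContinuousWithinAt, Filter.tendsto_def] using hcx
  obtain ⟨V, hVo, hxV, hVV⟩ := exists_open_disjoint_closure (y := f x)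
    (isOpen_interior (s := V')).isClosed_compl (by simpa [mem_interior_iff_mem_nhds] using hV')
  obtain ⟨W, hW, hxW, hWc⟩ : ∃ W, IsOpen W ∧ x ∈ W ∧
      ContinuouslyCovered f (W ∩ (S ∩ f ⁻¹' (closure V)ᶜ)) := by
    simpa [GermLarge] using hcon x hx.1 V hVo hxV
  obtain ⟨z, hzW, hzS, hzV⟩ : ∃ z ∈ W, z ∈ S \ G ∧ f z ∉ closure V := by
    by_contra! hall
    refine hVx (mem_nhdsWithin.2 ⟨W, hW, hxW, fun z hz => ?_⟩)
    have := disjoint_left.1 hVV (hall z hz.1 hz.2)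
    exact interior_subset (s := V') (not_not.1 this)
  obtain ⟨V₂, hV₂o, hzV₂, hV₂⟩ := exists_open_disjoint_closure isClosed_closure hzV
  obtain ⟨W₂, hW₂, hzW₂, hW₂c⟩ : ∃ W, IsOpen W ∧ z ∈ W ∧
      ContinuouslyCovered f (W ∩ (S ∩ f ⁻¹' (closure V₂)ᶜ)) := by
    simpa [GermLarge] using hcon z hzS.1 V₂ hV₂o hzV₂
  -- The closures of `V` and `V₂` are disjoint, so every value lies off one of them, and the two
  -- covers together cover `S` near `z`.
  refine hker z hzS (W ∩ W₂) (hW.inter hW₂) ⟨hzW, hzW₂⟩ ((hWc.union hW₂c).mono ?_)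
  rintro y ⟨⟨hy, hy₂⟩, hyS⟩
  by_cases hyV : f y ∈ closure V
  · exact Or.inr ⟨hy₂, hyS, disjoint_right.1 hV₂ hyV⟩
  · exact Or.inl ⟨hy, hyS, hyV⟩

/-- In `exists_germLarge` the neighbourhood of `f x` can be chosen so that removing its preimage
does not spoil finitely many given large germs. -/
theorem exists_germLarge_preserving [PseudoMetrizableSpace X] [RegularSpace Y]
    (hf : SigmaTwoMeasurable f) {T : Set X} (B : Finset X) (hB : ∀ b ∈ B, GermLarge f T b) :
    ∀ S : Set X, IsSigmaTwo S → ¬ ContinuouslyCovered f S →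
      ∃ x ∈ S, ∃ V, IsOpen V ∧ f x ∈ V ∧ GermLarge f (S ∩ f ⁻¹' (closure V)ᶜ) x ∧
        ∀ b ∈ B, GermLarge f (T ∩ f ⁻¹' (closure V)ᶜ) b := by
  classical
  induction B using Finset.induction_on with
  | empty =>
    intro S hS hnc
    obtain ⟨x, hx, V, hV, hxV, h⟩ := exists_germLarge hS hnc
    exact ⟨x, hx, V, hV, hxV, h, by simp⟩
  | insert b B _ ih =>
    intro S hS hnc
    have hbT := hB b (Finset.mem_insert_self b B)
    replace ih := ih fun c hc => hB c (Finset.mem_insert_of_mem hc)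
    obtain ⟨x, hx, V, hV, hxV, hgx, hgB⟩ := ih S hS hnc
    by_cases hb : GermLarge f (T ∩ f ⁻¹' (closure V)ᶜ) b
    · exact ⟨x, hx, V, hV, hxV, hgx, Finset.forall_mem_insert _ _ _ |>.2 ⟨hb, hgB⟩⟩
    obtain ⟨W, hW, hbW, hWc⟩ : ∃ W, IsOpen W ∧ b ∈ W ∧
        ContinuouslyCovered f (W ∩ (T ∩ f ⁻¹' (closure V)ᶜ)) := by
      simpa [GermLarge] using hb
    -- When `V` spoils `b`, a second choice is made off `closure V`. It cannot spoil `b` too: near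
    -- `b`, `T` would be covered off each of two disjoint closed sets of values, hence entirely.
    obtain ⟨z, hz, V₂, hV₂, hzV₂, hgz, hgB₂⟩ := ih _
      (hS.inter (hf _ isClosed_closure.isOpen_compl)) hgx.not_continuouslyCovered
    obtain ⟨V₃, hV₃, hzV₃, hd⟩ := exists_open_disjoint_closure isClosed_closure hz.2
    have hsub : ∀ R : Set X, R ∩ f ⁻¹' (closure V₂)ᶜ ⊆ R ∩ f ⁻¹' (closure (V₂ ∩ V₃))ᶜ :=
      fun R y hy => ⟨hy.1, fun h => hy.2 (closure_mono inter_subset_left h)⟩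
    refine ⟨z, hz.1, V₂ ∩ V₃, hV₂.inter hV₃, ⟨hzV₂, hzV₃⟩,
      (hgz.mono (hsub _)).mono (inter_subset_inter_left _ inter_subset_left), ?_⟩
    refine (Finset.forall_mem_insert _ _ _).2 ⟨fun W₂ hW₂ hbW₂ hc => ?_,
      fun c hc => (hgB₂ c hc).mono (hsub _)⟩
    refine hbT (W ∩ W₂) (hW.inter hW₂) ⟨hbW, hbW₂⟩ ((hWc.union hc).mono ?_)
    rintro y ⟨⟨hy, hy₂⟩, hyT⟩
    by_cases hyV : f y ∈ closure V
    · exact Or.inr ⟨hy₂, hyT, fun h =>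
        disjoint_right.1 hd hyV (closure_mono inter_subset_right h)⟩
    · exact Or.inl ⟨hy, hyT, hyV⟩

end ContinuouslyCovered

/-! ### Fine clopen partitions and dimension zero -/

/-- `K` has partitions into clopen sets of arbitrarily small diameter. -/
def HasFinePartitions (K : Type*) [PseudoMetricSpace K] : Prop :=
  ∀ ε > 0, ∃ c : K → ℕ, IsLocallyConstant c ∧ ∀ x y, c x = c y → dist x y < ε

/-- Points less than `δ` apart have centres less than `3 * δ` apart, hence the same centre, so the
choice of centre is locally constant. -/
theorem HasFinePartitions.of_separated_balls {X : Type*} [PseudoMetricSpace X] {K : Set X}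
    (h : ∀ ε > 0, ∃ A : Finset X, ∃ δ > 0, δ ≤ ε ∧
      (∀ a ∈ A, ∀ b ∈ A, a ≠ b → 3 * δ < dist a b) ∧ ∀ y ∈ K, ∃ a ∈ A, dist y a ≤ δ) :
    HasFinePartitions K := by
  intro ε hε
  obtain ⟨A, δ, hδ, hδε, hsep, hcov⟩ := h (ε / 3) (by positivity)
  choose a haA had using fun y : K => hcov y y.2
  obtain ⟨e, he⟩ := Countable.exists_injective_nat A
  refine ⟨fun y => e ⟨a y, haA y⟩, (IsLocallyConstant.iff_eventually_eq _).2 fun x => ?_,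
    fun x y hxy => ?_⟩
  · filter_upwards [Metric.ball_mem_nhds x hδ] with y hy
    congr 2
    by_contra hne
    have h1 := hsep _ (haA y) _ (haA x) hne
    have h2 := dist_triangle4 (a y) (y : X) x (a x)
    have h3 : dist (y : X) x < δ := hy
    have := had y
    have := had x
    rw [dist_comm (a y) (y : X)] at h2
    linarith
  · have hxy' : a x = a y := congrArg Subtype.val (he hxy)
    have h1 := had x
    have h2 := had y
    have h3 : dist (x : X) y ≤ dist (x : X) (a x) + dist (y : X) (a x) := dist_triangle_right _ _ _
    rw [← hxy'] at h2
    change dist (x : X) y < ε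
    linarith

/-- Each point is assigned a member of the cover containing its cell at the first level where one
exists. This assignment is locally constant, so its fibres form a disjoint open refinement. -/
theorem HasFinePartitions.coveringDimLE_zero {K : Type*} [PseudoMetricSpace K]
    (hK : HasFinePartitions K) : CoveringDimLE K 0 := by
  classical
  intro 𝒰 hfin hop hcov
  choose c hc hcd using fun n : ℕ => hK (1 / (n + 1)) (by positivity)
  have hex : ∀ x, ∃ n, ∃ U ∈ 𝒰, ∀ y, c n y = c n x → y ∈ U := fun x => by
    obtain ⟨U, hU, hxU⟩ : ∃ U ∈ 𝒰, x ∈ U := mem_sUnion.1 (hcov.symm ▸ mem_univ x : x ∈ ⋃₀ 𝒰)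
    obtain ⟨ε, hε, hball⟩ := Metric.isOpen_iff.1 (hop U hU) x hxU
    obtain ⟨n, hn⟩ := exists_nat_one_div_lt hε
    exact ⟨n, U, hU, fun y hy => hball ((hcd n y x hy).trans hn)⟩
  let N : K → ℕ := fun x => Nat.find (hex x)
  let P : K → Set (Set K) := fun x => {U | U ∈ 𝒰 ∧ ∀ y, c (N x) y = c (N x) x → y ∈ U}
  have hPne : ∀ x, (P x).Nonempty := fun x => Nat.find_spec (hex x)
  -- The choice depends on `x` only through the set `P x`, so equal sets give equal choices.
  let u : K → Set K := fun x => if h : (P x).Nonempty then h.choose else ∅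
  have hu : ∀ x, u x ∈ P x := fun x => by
    simpa [u, hPne x] using (hPne x).choose_spec
  have hloc : ∀ x, ∀ᶠ y in 𝓝 x, u y = u x := fun x => by
    have hev : ∀ᶠ y in 𝓝 x, ∀ m ∈ Finset.range (N x + 1), c m y = c m x :=
      (Filter.eventually_all_finset _).2 fun m _ =>
        (IsLocallyConstant.iff_eventually_eq _).1 (hc m) x
    filter_upwards [hev] with y hy
    have hy' : ∀ m ≤ N x, c m y = c m x := fun m hm => hy m (by simpa using Nat.lt_succ_of_le hm)
    have hN : N y = N x := by
      refine (Nat.find_eq_iff _).2 ⟨?_, fun m hm => ?_⟩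
      · rw [hy' _ le_rfl]
        exact Nat.find_spec (hex x)
      · rw [hy' m hm.le]
        exact Nat.find_min (hex x) hm
    have hP : P y = P x := by
      simp only [P, hN, hy' _ le_rfl]
    simp only [u, hP]
  have hopen : ∀ U, IsOpen {x | u x = U} := fun U => isOpen_iff_mem_nhds.2 fun x hx => by
    filter_upwards [hloc x] with y hy
    exact hy.trans hx
  refine ⟨(fun U => {x | u x = U}) '' 𝒰, hfin.image _, ?_, ?_, ?_, fun x => ?_⟩
  · rintro _ ⟨U, -, rfl⟩
    exact hopen U
  · exact eq_univ_of_forall fun x => ⟨_, ⟨u x, (hu x).1, rfl⟩, rfl⟩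
  · rintro _ ⟨U, hU, rfl⟩
    refine ⟨U, hU, ?_⟩
    rintro x rfl
    exact (hu x).2 x rfl
  · refine (ncard_le_one ((hfin.image _).subset (sep_subset _ _))).2 ?_
    rintro _ ⟨⟨U, -, rfl⟩, hU⟩ _ ⟨⟨V, -, rfl⟩, hV⟩
    have hU' : u x = U := hU
    have hV' : u x = V := hV
    simp [← hU', ← hV']

theorem CoveringDimLE.coveringDim_eq_zero {K : Type*} [TopologicalSpace K] [Nonempty K]
    (h : CoveringDimLE K 0) : coveringDim K = 0 := by
  have h0 : (⨅ (n : ℕ) (_ : CoveringDimLE K n), (n : ℕ∞) : ℕ∞) = 0 :=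
    nonpos_iff_eq_zero.1 (iInf₂_le 0 h)
  rw [coveringDim, if_neg (not_isEmpty_of_nonempty K), h0]
  rfl

/-! ### Sierpiński's characterisation of the rationals -/

theorem OrderTopology.of_isOpen_of_exists_Ioo {Z : Type*} [t : TopologicalSpace Z] [LinearOrder Z]
    (hIoi : ∀ a : Z, IsOpen (Ioi a)) (hIio : ∀ a : Z, IsOpen (Iio a))
    (h : ∀ s : Set Z, IsOpen s → ∀ x ∈ s, ∃ a b, x ∈ Ioo a b ∧ Ioo a b ⊆ s) :
    OrderTopology Z := by
  refine ⟨le_antisymm (le_generateFrom ?_) fun s hs => ?_⟩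
  · rintro _ ⟨a, rfl | rfl⟩
    exacts [hIoi a, hIio a]
  · choose! a b hx hab using h s hs
    have hs' : s = ⋃ x : s, Ioi (a x) ∩ Iio (b x) :=
      Subset.antisymm (fun x hxs => mem_iUnion.2 ⟨⟨x, hxs⟩, hx x hxs⟩)
        (iUnion_subset fun x => hab x x.2)
    rw [hs']
    refine @isOpen_iUnion _ _ (generateFrom _) _ fun x => ?_
    exact GenerateOpen.inter _ _ (GenerateOpen.basic _ ⟨_, Or.inl rfl⟩)
      (GenerateOpen.basic _ ⟨_, Or.inr rfl⟩)

section Sierpinski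

variable {Z : Type*} [MetricSpace Z]

theorem HasFinePartitions.exists_refinement (hZ : HasFinePartitions Z)
    (hne : ∀ x : Z, (𝓝[≠] x).NeBot) (x : Z) {g : Z → List ℤ} (hg : IsLocallyConstant g) {ε : ℝ}
    (hε : 0 < ε) :
    ∃ c : Z → ℤ, IsLocallyConstant c ∧ (∀ y z, c y = c z → dist y z < ε) ∧
      (∃ y, g y = g x ∧ c x < c y) ∧ ∃ y, g y = g x ∧ c y < c x := by
  have hO : IsOpen {y | g y = g x} := hg.isOpen_fiber _
  have key : ∀ O : Set Z, IsOpen O → x ∈ O → ∃ y ∈ O, y ≠ x := fun O hO hx => by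
    have := hne x
    obtain ⟨y, hy, hyx⟩ := Filter.nonempty_of_mem (f := 𝓝[≠] x)
      (Filter.inter_mem (mem_nhdsWithin_of_mem_nhds (hO.mem_nhds hx)) self_mem_nhdsWithin)
    exact ⟨y, hy, hyx⟩
  obtain ⟨y, hy, hyx⟩ := key _ hO rfl
  obtain ⟨z, ⟨hz, hzy⟩, hzx⟩ := key _ (hO.inter isOpen_ne) ⟨rfl, hyx.symm⟩
  have hzy : z ≠ y := hzy
  have hδ : 0 < min ε (min (dist y x) (min (dist z x) (dist z y))) := by
    simp [hε, hyx, hzx, hzy, dist_pos]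
  obtain ⟨b, hb, hbd⟩ := hZ _ hδ
  have h1 : b y ≠ b x := fun h => by simpa using hbd _ _ h
  have h2 : b z ≠ b x := fun h => by simpa using hbd _ _ h
  have h3 : b z ≠ b y := fun h => by simpa using hbd _ _ h
  -- Relabelling puts the cell of `z` below that of `x` and the cell of `y` above it.
  let σ : ℕ → ℤ := fun k => if k = b z then -1 else if k = b x then 0 else k + 1
  have hσ : Function.Injective σ := fun k l hkl => by
    simp only [σ] at hkl
    split_ifs at hkl <;> omega
  refine ⟨σ ∘ b, hb.comp σ, fun p q hpq => (hbd p q (hσ hpq)).trans_le (min_le_left _ _),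
    ⟨y, hy, ?_⟩, z, hz, ?_⟩
  · simp only [Function.comp, σ, h2.symm, h3.symm, h1, if_false, if_true]
    positivity
  · simp [σ, h2.symm]

/-- Unpairing the stage makes every point the base point of arbitrarily late refinements, so each of
its cells contains points on both sides of it. -/
theorem HasFinePartitions.exists_seq [Countable Z] [Nonempty Z] (hZ : HasFinePartitions Z)
    (hne : ∀ x : Z, (𝓝[≠] x).NeBot) :
    ∃ c : ℕ → Z → ℤ, (∀ n, IsLocallyConstant (c n)) ∧
      (∀ n y z, c n y = c n z → dist y z < 1 / (n + 1)) ∧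
      (∀ x n, ∃ m ≥ n, ∃ y, (∀ i < m, c i y = c i x) ∧ c m x < c m y) ∧
      ∀ x n, ∃ m ≥ n, ∃ y, (∀ i < m, c i y = c i x) ∧ c m y < c m x := by
  obtain ⟨e, he⟩ := exists_surjective_nat Z
  choose step hs₁ hs₂ hs₃ hs₄ using fun (n : ℕ) (g : {g : Z → List ℤ // IsLocallyConstant g}) =>
    hZ.exists_refinement hne (e n.unpair.1) g.2 (ε := 1 / (n + 1)) (by positivity)
  let G : ℕ → {g : Z → List ℤ // IsLocallyConstant g} := fun n =>
    Nat.rec ⟨fun _ => [], IsLocallyConstant.const _⟩ (fun n g =>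
      ⟨fun z => step n g z :: g.1 z, (hs₁ n g).comp₂ g.2 List.cons⟩) n
  have hG : ∀ n z, (G (n + 1)).1 z = step n (G n) z :: (G n).1 z := fun _ _ => rfl
  have hagree : ∀ n y z, (G n).1 y = (G n).1 z → ∀ i < n, step i (G i) y = step i (G i) z := by
    intro n y z
    induction n with
    | zero => simp
    | succ n ih =>
      intro h i hi
      rw [hG, hG, List.cons.injEq] at h
      rcases Nat.lt_succ_iff_lt_or_eq.1 hi with hi | rfl
      exacts [ih h.2 i hi, h.1]
  have hidx : ∀ x n, ∃ m ≥ n, e (Nat.unpair m).1 = x := fun x n => by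
    obtain ⟨k, rfl⟩ := he x
    exact ⟨Nat.pair k n, Nat.right_le_pair k n, by simp⟩
  refine ⟨fun n => step n (G n), fun n => hs₁ _ _, fun n => hs₂ _ _, fun x n => ?_,
    fun x n => ?_⟩
  · obtain ⟨m, hm, rfl⟩ := hidx x n
    obtain ⟨y, hy, hlt⟩ := hs₃ m (G m)
    exact ⟨m, hm, y, hagree m _ _ hy, hlt⟩
  · obtain ⟨m, hm, rfl⟩ := hidx x n
    obtain ⟨y, hy, hlt⟩ := hs₄ m (G m)
    exact ⟨m, hm, y, hagree m _ _ hy, hlt⟩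

/-- Sierpiński's theorem: a countable metric space without isolated points is homeomorphic to `ℚ`,
here for spaces with fine clopen partitions. -/
theorem HasFinePartitions.nonempty_homeomorph_rat [Countable Z] [Nonempty Z]
    (hZ : HasFinePartitions Z) (hne : ∀ x : Z, (𝓝[≠] x).NeBot) : Nonempty (Z ≃ₜ ℚ) := by
  obtain ⟨c, hc, hcd, hgt, hlt⟩ := hZ.exists_seq hne
  have hinj : Function.Injective fun z : Z => toLex fun n => c n z := fun y z hyz => by
    refine eq_of_forall_dist_le fun ε hε => ?_
    obtain ⟨n, hn⟩ := exists_nat_one_div_lt hε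
    exact ((hcd n y z (congrFun hyz n)).trans hn).le
  -- Under the lexicographic order of labels, cells are convex with no endpoints. The order topology
  -- is therefore the metric one, and Cantor's theorem applies.
  let _ : LinearOrder Z := LinearOrder.lift' _ hinj
  have hltdef : ∀ y z : Z, y < z ↔ ∃ i, (∀ j < i, c j y = c j z) ∧ c i y < c i z :=
    fun y z => Iff.rfl
  have hup : ∀ (x : Z) n, ∃ y, (∀ i < n, c i y = c i x) ∧ x < y := fun x n => by
    obtain ⟨m, hm, y, hy, hxy⟩ := hgt x n
    exact ⟨y, fun i hi => hy i (hi.trans_le hm), (hltdef _ _).2 ⟨m, fun j hj => (hy j hj).symm, hxy⟩⟩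
  have hdown : ∀ (x : Z) n, ∃ y, (∀ i < n, c i y = c i x) ∧ y < x := fun x n => by
    obtain ⟨m, hm, y, hy, hxy⟩ := hlt x n
    exact ⟨y, fun i hi => hy i (hi.trans_le hm), (hltdef _ _).2 ⟨m, hy, hxy⟩⟩
  have hleft : ∀ x y : Z, x < y → ∃ n, ∀ z, (∀ i < n, c i z = c i x) → z < y := by
    intro x y hxy
    obtain ⟨i, hi, hlt⟩ := (hltdef _ _).1 hxy
    refine ⟨i + 1, fun z hz => (hltdef _ _).2 ⟨i, fun j hj => ?_, ?_⟩⟩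
    · rw [hz j (by omega), hi j hj]
    · rwa [hz i (by omega)]
  have hright : ∀ x y : Z, y < x → ∃ n, ∀ z, (∀ i < n, c i z = c i x) → y < z := by
    intro x y hxy
    obtain ⟨i, hi, hlt⟩ := (hltdef _ _).1 hxy
    refine ⟨i + 1, fun z hz => (hltdef _ _).2 ⟨i, fun j hj => ?_, ?_⟩⟩
    · rw [hz j (by omega), hi j hj]
    · rwa [hz i (by omega)]
  have hconv : ∀ (x a b : Z) n, (∀ i < n, c i a = c i x) → (∀ i < n, c i b = c i x) →
      ∀ z ∈ Ioo a b, ∀ i < n, c i z = c i x := by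
    rintro x a b n ha hb z ⟨haz, hzb⟩ i hi
    obtain ⟨k, hk, hkl⟩ := (hltdef _ _).1 haz
    obtain ⟨l, hl, hll⟩ := (hltdef _ _).1 hzb
    by_cases hik : i < k
    · rw [← hk i hik, ha i hi]
    by_cases hil : i < l
    · rw [hl i hil, hb i hi]
    exfalso
    rcases lt_trichotomy k l with h | h | h
    · have := hl k h
      rw [hb k (by omega), ← ha k (by omega)] at this
      omega
    · subst h
      rw [hb k (by omega)] at hll
      rw [ha k (by omega)] at hkl
      omega
    · have := hk l h
      rw [ha l (by omega), ← hb l (by omega)] at this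
      omega
  have hcyl : ∀ (x : Z) n, {z | ∀ i < n, c i z = c i x} ∈ 𝓝 x := fun x n => by
    have hev : ∀ᶠ z in 𝓝 x, ∀ i ∈ Finset.range n, c i z = c i x :=
      (Filter.eventually_all_finset _).2 fun i _ =>
        (IsLocallyConstant.iff_eventually_eq _).1 (hc i) x
    filter_upwards [hev] with z hz i hi using hz i (Finset.mem_range.2 hi)
  have : OrderTopology Z := by
    refine OrderTopology.of_isOpen_of_exists_Ioo (fun a => isOpen_iff_mem_nhds.2 fun x hx => ?_)
      (fun a => isOpen_iff_mem_nhds.2 fun x hx => ?_) fun s hs x hx => ?_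
    · obtain ⟨n, hn⟩ := hright x a hx
      exact Filter.mem_of_superset (hcyl x n) hn
    · obtain ⟨n, hn⟩ := hleft x a hx
      exact Filter.mem_of_superset (hcyl x n) hn
    · obtain ⟨ε, hε, hball⟩ := Metric.isOpen_iff.1 hs x hx
      obtain ⟨n, hn⟩ := exists_nat_one_div_lt hε
      obtain ⟨a, ha, hax⟩ := hdown x (n + 1)
      obtain ⟨b, hb, hxb⟩ := hup x (n + 1)
      refine ⟨a, b, ⟨hax, hxb⟩, fun z hz => hball ?_⟩
      exact (hcd n z x (hconv x a b _ ha hb z hz n (by omega))).trans hn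
  have : DenselyOrdered Z := ⟨fun x y hxy => by
    obtain ⟨n, hn⟩ := hleft x y hxy
    obtain ⟨z, hz, hxz⟩ := hup x n
    exact ⟨z, hxz, hn z hz⟩⟩
  have : NoMinOrder Z := ⟨fun x => let ⟨y, _, hy⟩ := hdown x 0; ⟨y, hy⟩⟩
  have : NoMaxOrder Z := ⟨fun x => let ⟨y, _, hy⟩ := hup x 0; ⟨y, hy⟩⟩
  obtain ⟨φ⟩ := Order.iso_of_countable_dense Z ℚ
  exact ⟨φ.toHomeomorph⟩

end Sierpinski

/-! ### Finite approximations and their extensions -/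

/-- A finite approximation to a set `Z` on which `f` is injective with relatively discrete image:
the points `A` are in `Z`, the values of `f` at the remaining points of `Z` avoid `N`, and `Z` is
contained in `O`. -/
structure DiscreteApprox {X Y : Type*} [TopologicalSpace X] [TopologicalSpace Y] (f : X → Y) where
  A : Finset X
  N : Set Y
  O : Set X
  nonempty : A.Nonempty
  isOpen_N : IsOpen N
  isOpen_O : IsOpen O
  subset_O : ∀ a ∈ A, a ∈ O
  separated : ∀ a ∈ A, ∃ U, IsOpen U ∧ U ⊆ N ∧ f a ∈ U ∧ ∀ b ∈ A, f b ∈ U → b = a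
  germLarge : ∀ a ∈ A, GermLarge f (f ⁻¹' (closure N)ᶜ) a

namespace DiscreteApprox

/-- `q` refines `p`. -/
structure Refines {X Y : Type*} [TopologicalSpace X] [TopologicalSpace Y] {f : X → Y}
    (p q : DiscreteApprox f) : Prop where
  A_subset : p.A ⊆ q.A
  N_subset : p.N ⊆ q.N
  O_subset : q.O ⊆ p.O
  avoids : ∀ x ∈ q.A, x ∉ p.A → f x ∉ p.N

section

variable {X Y : Type*} [TopologicalSpace X] [TopologicalSpace Y] {f : X → Y}

theorem Refines.refl (p : DiscreteApprox f) : p.Refines p :=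
  ⟨subset_rfl, subset_rfl, subset_rfl, fun _ h h' => absurd h h'⟩

theorem Refines.trans {p q r : DiscreteApprox f} (h : p.Refines q) (h' : q.Refines r) :
    p.Refines r := by
  refine ⟨h.A_subset.trans h'.A_subset, h.N_subset.trans h'.N_subset,
    h'.O_subset.trans h.O_subset, fun x hx hxp => ?_⟩
  by_cases hxq : x ∈ q.A
  · exact h.avoids x hxq hxp
  · exact fun hN => h'.avoids x hx hxq (h.N_subset hN)

theorem Refines.of_le {p : ℕ → DiscreteApprox f} (h : ∀ n, (p n).Refines (p (n + 1))) {m n : ℕ}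
    (hmn : m ≤ n) : (p m).Refines (p n) := by
  induction n, hmn using Nat.le_induction with
  | base => exact Refines.refl _
  | succ n _ ih => exact ih.trans (h n)

theorem nonempty_of_not_piecewiseContinuous [PseudoMetrizableSpace X] [RegularSpace Y]
    (h : ¬ PiecewiseContinuous f) : Nonempty (DiscreteApprox f) := by
  obtain ⟨x, -, V, hV, hxV, hx⟩ := exists_germLarge (f := f) isClosed_univ.isSigmaTwo
    fun hc => h hc.piecewiseContinuous
  exact ⟨⟨{x}, V, univ, by simp, hV, isOpen_univ, by simp,
    by simpa using ⟨V, hV, subset_rfl, hxV⟩,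
    by simpa using hx⟩⟩

/-- Near every point of `A` there is a further point which can be added. -/
theorem exists_insert [PseudoMetrizableSpace X] [RegularSpace Y] (hf : SigmaTwoMeasurable f)
    (p : DiscreteApprox f) {a : X} (ha : a ∈ p.A) {W : Set X} (hW : IsOpen W) (haW : a ∈ W) :
    ∃ q : DiscreteApprox f, p.Refines q ∧ ∃ x ∈ q.A, x ∈ W ∧ x ≠ a := by
  classical
  have hT : IsSigmaTwo (f ⁻¹' (closure p.N)ᶜ) := hf _ isClosed_closure.isOpen_compl
  obtain ⟨x, ⟨⟨hxW, hxO⟩, hxN⟩, V, hV, hxV, hgx, hgA⟩ :=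
    exists_germLarge_preserving hf p.A p.germLarge _ ((hW.inter p.isOpen_O).isSigmaTwo.inter hT)
      (p.germLarge a ha (W ∩ p.O) (hW.inter p.isOpen_O) ⟨haW, p.subset_O a ha⟩)
  have hfA : ∀ b ∈ p.A, f b ∈ p.N := fun b hb => by
    obtain ⟨U, -, hUN, hbU, -⟩ := p.separated b hb
    exact hUN hbU
  have hxN' : f x ∉ p.N := fun h => hxN (subset_closure h)
  -- Cutting off `closure p.N` keeps the old values out of the new neighbourhood.
  set V' := V ∩ (closure p.N)ᶜ with hV'
  have hsub : ∀ y, f y ∉ closure p.N → f y ∉ closure V → f y ∉ closure (p.N ∪ V') := by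
    intro y hy hyV h
    rw [closure_union] at h
    rcases h with h | h
    exacts [hy h, hyV (closure_mono inter_subset_left h)]
  refine ⟨⟨insert x p.A, p.N ∪ V', p.O, Finset.insert_nonempty _ _,
    p.isOpen_N.union (hV.inter isClosed_closure.isOpen_compl), p.isOpen_O,
    (Finset.forall_mem_insert _ _ _).2 ⟨hxO, p.subset_O⟩,
    (Finset.forall_mem_insert _ _ _).2 ⟨⟨V', hV.inter isClosed_closure.isOpen_compl,
      subset_union_right, ⟨hxV, hxN⟩, ?_⟩, fun b hb => ?_⟩,
    (Finset.forall_mem_insert _ _ _).2 ⟨hgx.mono ?_, fun b hb => (hgA b hb).mono ?_⟩⟩,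
    ⟨Finset.subset_insert _ _, subset_union_left, subset_rfl, ?_⟩,
    x, Finset.mem_insert_self _ _, hxW, ?_⟩
  · exact (Finset.forall_mem_insert _ _ _).2 ⟨fun _ => rfl, fun b hb h =>
      absurd (subset_closure (hfA b hb)) h.2⟩
  · obtain ⟨U, hU, hUN, hbU, hUA⟩ := p.separated b hb
    exact ⟨U, hU, hUN.trans subset_union_left, hbU,
      (Finset.forall_mem_insert _ _ _).2 ⟨fun h => absurd (hUN h) hxN', hUA⟩⟩
  · rintro y ⟨⟨-, hy⟩, hyV⟩
    exact hsub y hy hyV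
  · rintro y ⟨hy, hyV⟩
    exact hsub y hy hyV
  · intro y hy hyp _
    obtain rfl : y = x := (Finset.mem_insert.1 hy).resolve_right hyp
    contradiction
  · rintro rfl
    exact hxN' (hfA x ha)

end

section

variable {X Y : Type*} [PseudoMetricSpace X] [TopologicalSpace Y] {f : X → Y}

theorem exists_crowding [RegularSpace Y] (hf : SigmaTwoMeasurable f) (p : DiscreteApprox f) {ε : ℝ}
    (hε : 0 < ε) : ∃ q : DiscreteApprox f, p.Refines q ∧
      ∀ a ∈ p.A, ∃ x ∈ q.A, x ≠ a ∧ dist x a < ε := by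
  classical
  suffices h : ∀ B : Finset X, B ⊆ p.A → ∃ q : DiscreteApprox f, p.Refines q ∧
      ∀ a ∈ B, ∃ x ∈ q.A, x ≠ a ∧ dist x a < ε from h p.A subset_rfl
  intro B
  induction B using Finset.induction_on with
  | empty => exact fun _ => ⟨p, Refines.refl p, by simp⟩
  | insert b B _ ih =>
    intro hB
    obtain ⟨q, hpq, hq⟩ := ih ((Finset.subset_insert _ _).trans hB)
    obtain ⟨r, hqr, x, hx, hxb, hne⟩ := q.exists_insert hf
      (hpq.A_subset (hB (Finset.mem_insert_self b B))) Metric.isOpen_ball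
      (Metric.mem_ball_self hε)
    refine ⟨r, hpq.trans hqr, (Finset.forall_mem_insert _ _ _).2 ⟨⟨x, hx, hne, hxb⟩, fun a ha => ?_⟩⟩
    obtain ⟨y, hy, h⟩ := hq a ha
    exact ⟨y, hqr.A_subset hy, h⟩

end

/-- Confining all later points to tiny balls around the present ones is what controls the closure of
the final set. -/
theorem exists_shrink {X Y : Type*} [MetricSpace X] [TopologicalSpace Y] {f : X → Y}
    (p : DiscreteApprox f) {ε : ℝ} (hε : 0 < ε) :
    ∃ q : DiscreteApprox f, p.Refines q ∧ ∃ δ > 0, δ ≤ ε ∧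
      (∀ a ∈ q.A, ∀ b ∈ q.A, a ≠ b → 3 * δ < dist a b) ∧ ∀ y ∈ q.O, ∃ a ∈ q.A, dist y a < δ := by
  have hev : ∀ᶠ δ : ℝ in 𝓝[>] 0, ∀ a ∈ p.A, ∀ b ∈ p.A, a ≠ b → 3 * δ < dist a b := by
    refine (Filter.eventually_all_finset _).2 fun a _ =>
      (Filter.eventually_all_finset _).2 fun b _ => ?_
    rcases eq_or_ne a b with hab | hab
    · exact Filter.Eventually.of_forall fun _ h => absurd hab h
    have : Filter.Tendsto (fun δ : ℝ => 3 * δ) (𝓝[>] 0) (𝓝 (3 * 0)) :=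
      ((continuous_const.mul continuous_id).tendsto 0).mono_left nhdsWithin_le_nhds
    rw [mul_zero] at this
    filter_upwards [this.eventually_lt_const (dist_pos.2 hab)] with δ hδ _ using hδ
  obtain ⟨δ, hδ, hδ₀, hδε⟩ := (hev.and (Ioc_mem_nhdsGT hε)).exists
  refine ⟨⟨p.A, p.N, p.O ∩ ⋃ a ∈ p.A, Metric.ball a δ, p.nonempty, p.isOpen_N,
    p.isOpen_O.inter (isOpen_biUnion fun _ _ => Metric.isOpen_ball), fun a ha =>
      ⟨p.subset_O a ha, mem_biUnion ha (Metric.mem_ball_self hδ₀)⟩, p.separated, p.germLarge⟩,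
    ⟨subset_rfl, subset_rfl, inter_subset_left, fun _ h h' => absurd h h'⟩,
    δ, hδ₀, hδε, hδ, fun y hy => ?_⟩
  simpa using hy.2

end DiscreteApprox

/-! ### Construction of `Z` -/

theorem lemma3 {X : Type*} {Y : Type*} [TopologicalSpace X] [TopologicalSpace.MetrizableSpace X]
    [TopologicalSpace Y] [RegularSpace Y] (f : X → Y)
    (hf : SigmaTwoMeasurable f) (hnpc : ¬ PiecewiseContinuous f) :
    ∃ Z : Set X,
      Nonempty (Z ≃ₜ ℚ) ∧
      Set.BijOn f Z (f '' Z) ∧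
      RelativelyDiscrete (f '' Z) ∧
      coveringDim (closure Z) = 0 := by
  let _ : MetricSpace X := metrizableSpaceMetric X
  obtain ⟨p₀⟩ := DiscreteApprox.nonempty_of_not_piecewiseContinuous hnpc
  have hstep : ∀ (n : ℕ) (p : DiscreteApprox f), ∃ q : DiscreteApprox f, p.Refines q ∧
      (∀ a ∈ p.A, ∃ x ∈ q.A, x ≠ a ∧ dist x a < 1 / (n + 1)) ∧
      ∃ δ > 0, δ ≤ 1 / ((n : ℝ) + 1) ∧ (∀ a ∈ q.A, ∀ b ∈ q.A, a ≠ b → 3 * δ < dist a b) ∧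
        ∀ y ∈ q.O, ∃ a ∈ q.A, dist y a < δ := fun n p => by
    have hn : (0 : ℝ) < 1 / (n + 1) := by positivity
    -- Crowding precedes shrinking so that `δ` also separates the newly added points.
    obtain ⟨q, hpq, hq⟩ := p.exists_crowding hf hn
    obtain ⟨r, hqr, hr⟩ := q.exists_shrink hn
    refine ⟨r, hpq.trans hqr, fun a ha => ?_, hr⟩
    obtain ⟨x, hx, h⟩ := hq a ha
    exact ⟨x, hqr.A_subset hx, h⟩
  choose next href hcrowd hsep using hstep
  let p : ℕ → DiscreteApprox f := fun n => Nat.rec p₀ next n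
  have hp : ∀ n, p (n + 1) = next n (p n) := fun _ => rfl
  have hle : ∀ {m n}, m ≤ n → (p m).Refines (p n) := DiscreteApprox.Refines.of_le fun n => href n _
  set Z : Set X := ⋃ n, ((p n).A : Set X) with hZ
  have hmem : ∀ {z}, z ∈ Z ↔ ∃ n, z ∈ (p n).A := by simp [hZ]
  have hZO : ∀ n, Z ⊆ (p n).O := fun n z hz => by
    obtain ⟨m, hm⟩ := hmem.1 hz
    exact (hle (le_max_right m n)).O_subset
      ((p _).subset_O z ((hle (le_max_left m n)).A_subset hm))
  have hdisc : ∀ a ∈ Z, ∃ U, IsOpen U ∧ f a ∈ U ∧ ∀ b ∈ Z, f b ∈ U → b = a := fun a ha => by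
    obtain ⟨n, hn⟩ := hmem.1 ha
    obtain ⟨U, hU, hUN, haU, h⟩ := (p n).separated a hn
    refine ⟨U, hU, haU, fun b hb hbU => ?_⟩
    obtain ⟨m, hm⟩ := hmem.1 hb
    by_cases hbn : b ∈ (p n).A
    · exact h b hbn hbU
    -- A point added after stage `n` has its value outside `(p n).N`, which contains `U`.
    · exact absurd (hUN hbU) ((hle (le_max_left n m)).avoids b
        ((hle (le_max_right n m)).A_subset hm) hbn)
  have hfine : ∀ K ⊆ closure Z, HasFinePartitions K := fun K hK => by
    refine HasFinePartitions.of_separated_balls fun ε hε => ?_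
    obtain ⟨n, hn⟩ := exists_nat_one_div_lt hε
    obtain ⟨δ, hδ, hδn, hδs, hδO⟩ := hsep n (p n)
    refine ⟨(p (n + 1)).A, δ, hδ, hδn.trans hn.le, hδs, fun y hy => ?_⟩
    -- Finitely many closed balls contain `Z`, hence also its closure; this is why the covering
    -- inequality is not strict.
    have hcl : IsClosed (⋃ a ∈ (p (n + 1)).A, Metric.closedBall a δ) :=
      (p (n + 1)).A.finite_toSet.isClosed_biUnion fun _ _ => Metric.isClosed_closedBall
    have hsub : Z ⊆ ⋃ a ∈ (p (n + 1)).A, Metric.closedBall a δ := fun z hz => by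
      obtain ⟨a, ha, hza⟩ := hδO z (hZO (n + 1) hz)
      exact mem_biUnion ha hza.le
    simpa using closure_minimal hsub hcl (hK hy)
  have hZne : Z.Nonempty := (p 0).nonempty.imp fun a ha => hmem.2 ⟨0, ha⟩
  have hZc : Z.Countable := countable_iUnion fun n => (p n).A.countable_toSet
  have : Nonempty Z := hZne.to_subtype
  have : Nonempty (closure Z) := hZne.closure.to_subtype
  have : Countable Z := hZc.to_subtype
  have hinj : InjOn f Z := fun a ha b hb hab => by
    obtain ⟨U, -, hbU, h⟩ := hdisc b hb
    exact h a ha (hab ▸ hbU)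
  refine ⟨Z, (hfine Z subset_closure).nonempty_homeomorph_rat fun z => ?_, hinj.bijOn_image, ?_,
    (hfine _ subset_rfl).coveringDimLE_zero.coveringDim_eq_zero⟩
  · rw [← mem_closure_iff_nhdsWithin_neBot, Metric.mem_closure_iff]
    intro ε hε
    obtain ⟨k, hk⟩ := hmem.1 z.2
    obtain ⟨n, hn⟩ := exists_nat_one_div_lt hε
    obtain ⟨x, hx, hxz, hd⟩ := hcrowd (max k n) _ z ((hle (le_max_left k n)).A_subset hk)
    refine ⟨⟨x, hmem.2 ⟨max k n + 1, hx⟩⟩, fun h => hxz (congrArg Subtype.val h), ?_⟩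
    rw [dist_comm]
    refine hd.trans_le (le_trans ?_ hn.le)
    exact Nat.one_div_le_one_div (le_max_right k n)
  · rintro _ ⟨a, ha, rfl⟩
    obtain ⟨U, hU, haU, h⟩ := hdisc a ha
    refine ⟨U, hU, Subset.antisymm ?_ (singleton_subset_iff.2 ⟨haU, a, ha, rfl⟩)⟩
    rintro _ ⟨hbU, b, hb, rfl⟩
    rw [h b hb hbU]
    rfl
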